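/- Let $2^\omega$ be the Cantor space with its product topology and its Lebesgue (fair coin-tossing product) measure. Let $\mathrm{cov}(\mathcal N)$ be the minimal cardinality of a family of Lebesgue-null subsets of $2^\omega$ whose union is $2^\omega$, let $\mathfrak b$ be the minimal cardinality of a family of functions $\omega\to\omega$ that is unbounded with respect to eventual domination $\leq^*$, and let $\mathfrak c=2^{\aleph_0}$. A space $X$ is Hurewicz if for every sequence $\mathcal U_0,\mathcal U_1,\dots$ of open covers of $X$ there are finite sets $\mathcal F_n\subseteq\mathcal U_n$ such that every $x\in X$ belongs to $\bigcup\mathcal F_n$ for all but finitely many $n$. An open $\gamma$-cover of $X$ is an infinite family of open subsets of $X$ such that every $x\in X$ belongs to all but finitely many members of the family. A space $X$ satisfies $\mathsf S_1(\Gamma,\mathrm O)$ if for every sequence $\mathcal U_0,\mathcal U_1,\dots$ of open $\gamma$-covers of $X$ there are $U_n\in\mathcal U_n$ ($n\in\omega$) with $\bigcup_n U_n=X$. A set $X\subseteq 2^\omega$ is totally imperfect if it contains no homeomorphic copy of $2^\omega$. Then the Cantor space $2^\omega$ does not satisfy $\mathsf S_1(\Gamma,\mathrm O)$. Moreover, if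 $\mathrm{cov}(\mathcal N)=\mathfrak b=\mathfrak c$, then there is a set $X\subseteq 2^\omega$ which, with the subspace topology, is Hurewicz, is totally imperfect, can be mapped continuously onto $2^\omega$, and does not satisfy $\mathsf S_1(\Gamma,\mathrm O)$. -/

import Mathlib

open MeasureTheory Filter Cardinal

/-- The Cantor space `2^ω` with the product topology (and the product σ-algebra). -/
abbrev CantorSpace : Type := ℕ → Bool

/-- Every sequence `𝒰 0, 𝒰 1, …` of open covers of the space `X` admits finite sets
`ℱ n ⊆ 𝒰 n` such that every point of `X` belongs to `⋃ ℱ n` for all but finitely many `n`. -/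
def IsHurewicz (X : Type*) [TopologicalSpace X] : Prop :=
  ∀ 𝒰 : ℕ → Set (Set X),
    (∀ n, (∀ U ∈ 𝒰 n, IsOpen U) ∧ ⋃₀ 𝒰 n = Set.univ) →
    ∃ ℱ : ℕ → Set (Set X),
      (∀ n, ℱ n ⊆ 𝒰 n ∧ (ℱ n).Finite) ∧ ∀ x : X, {n | x ∉ ⋃₀ ℱ n}.Finite

/-- An open γ-cover of `X`: an infinite family of open sets such that every point of `X`
belongs to all but finitely many members of the family. -/
def IsOpenGammaCover {X : Type*} [TopologicalSpace X] (𝒰 : Set (Set X)) : Prop :=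
  (∀ U ∈ 𝒰, IsOpen U) ∧ 𝒰.Infinite ∧ ∀ x : X, {U ∈ 𝒰 | x ∉ U}.Finite

/-- The property `S₁(Γ, O)`: from every sequence of open γ-covers of `X` one can select one member
of each so that the selected sets cover `X`. -/
def IsS1GammaO (X : Type*) [TopologicalSpace X] : Prop :=
  ∀ 𝒰 : ℕ → Set (Set X), (∀ n, IsOpenGammaCover (𝒰 n)) →
    ∃ U : ℕ → Set X, (∀ n, U n ∈ 𝒰 n) ∧ ⋃ n, U n = Set.univ

/-- A set is totally imperfect if it contains no homeomorphic copy of the Cantor space. -/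
def IsTotallyImperfect {Y : Type*} [TopologicalSpace Y] (X : Set Y) : Prop :=
  ¬ ∃ P : Set Y, P ⊆ X ∧ Nonempty (P ≃ₜ CantorSpace)

/-- The Lebesgue measure on the Cantor space: the product of the uniform measures on `{0, 1}`. -/
noncomputable def cantorMeasure : Measure CantorSpace :=
  Measure.infinitePi fun _ : ℕ => (PMF.uniformOfFintype Bool).toMeasure

/-- `cov(𝒩)`: the minimal cardinality of a family of null sets covering the Cantor space. -/
noncomputable def covNull : Cardinal.{0} :=
  sInf {κ | ∃ 𝒜 : Set (Set CantorSpace),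
    (∀ A ∈ 𝒜, cantorMeasure A = 0) ∧ ⋃₀ 𝒜 = Set.univ ∧ #𝒜 = κ}

/-- The bounding number `𝔟`: the minimal cardinality of a family of functions `ℕ → ℕ` that is
unbounded with respect to eventual domination. -/
noncomputable def boundingNumber : Cardinal.{0} :=
  sInf {κ | ∃ B : Set (ℕ → ℕ),
    (¬ ∃ g : ℕ → ℕ, ∀ f ∈ B, ∀ᶠ n in atTop, f n ≤ g n) ∧ #B = κ}

/-! ### The measure on the Cantor space -/

/-! Read points of the Cantor space as matrices. For each row, the complements of the
`firstTrueSet`s form a γ-cover, and any selection misses a matrix whose rows have their first `true`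
at the selected places. Pulling back along a continuous surjection refutes `IsS1GammaO` in both
claims. The set `X` is built in the plane with a point on every vertical line, so the first
projection is onto. Two properties carry the rest (`exists_plane_set`): an `F_σ` set missing `X` has
null vertical sections, and the complement of an `F_σ` set with null sections contains a `σ`-compact
set holding all but fewer than `𝔠` points of `X`. Together they verify the criterion
`isHurewicz_of_exists_isCompact`, as `𝔟 = 𝔠`. By the second, closed subsets of `X` with null
sections have size below `𝔠`; a Cantor set in `X` would always contain one of size `𝔠`. -/

instance : IsProbabilityMeasure cantorMeasure := by
  unfold cantorMeasure; infer_instance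

/-- Flipping the coordinates in a finite set `q`. -/
def flipCoords (q : Finset ℕ) (x : CantorSpace) : CantorSpace :=
  fun n => if n ∈ q then !x n else x n

theorem measurePreserving_flipCoords (q : Finset ℕ) :
    MeasurePreserving (flipCoords q) cantorMeasure cantorMeasure := by
  let f : ∀ _ : ℕ, Bool → Bool := fun n b => if n ∈ q then !b else b
  have hf : ∀ n, Measurable (f n) := fun n => measurable_of_countable _
  refine ⟨measurable_pi_lambda _ fun n => (hf n).comp (measurable_pi_apply n), ?_⟩
  have h := Measure.infinitePi_map_pi
    (fun _ : ℕ => (PMF.uniformOfFintype Bool).toMeasure) hf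
  have hnot : ((PMF.uniformOfFintype Bool).toMeasure).map (fun b => !b) =
      (PMF.uniformOfFintype Bool).toMeasure := by
    refine Measure.ext_of_singleton fun b => ?_
    rw [Measure.map_apply (measurable_of_countable _) (MeasurableSet.singleton b)]
    have : (fun b => !b) ⁻¹' {b} = {!b} := by ext c; cases b <;> cases c <;> simp
    rw [this, PMF.toMeasure_apply_singleton _ _ (MeasurableSet.singleton _),
      PMF.toMeasure_apply_singleton _ _ (MeasurableSet.singleton _)]
    simp
  have hmap : ∀ n, ((PMF.uniformOfFintype Bool).toMeasure).map (f n) =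
      (PMF.uniformOfFintype Bool).toMeasure := by
    intro n
    by_cases hn : n ∈ q
    · simpa only [f, if_pos hn] using hnot
    · simp only [f, if_neg hn]; exact Measure.map_id
  simp only [hmap] at h
  exact h

open ProbabilityTheory in
/-- A measurable set that does not depend on any finite number of coordinates has measure `0` or
`1`. -/
theorem cantorMeasure_eq_zero_or_one {R : Set CantorSpace} (hR : MeasurableSet R)
    (hinv : ∀ x y : CantorSpace, (∀ᶠ n in atTop, x n = y n) → x ∈ R → y ∈ R) :
    cantorMeasure R = 0 ∨ cantorMeasure R = 1 := by
  have hind := iIndepFun_infinitePi (P := fun _ : ℕ => (PMF.uniformOfFintype Bool).toMeasure)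
    (X := fun _ b => b) (fun _ => measurable_id)
  refine measure_zero_or_one_of_measurableSet_limsup_atTop
    (s := fun n => MeasurableSpace.comap (fun x : CantorSpace => x n) inferInstance)
    (fun n => (measurable_pi_apply n).comap_le) hind ?_
  rw [limsup_eq_iInf_iSup_of_nat, MeasurableSpace.measurableSet_iInf]
  intro n
  -- Resetting the coordinates below `n` does not affect membership in `R`, and `ρ` is measurable
  -- for the coordinates from `n` on.
  let ρ : CantorSpace → CantorSpace := fun x i => if i < n then false else x i
  have hρ : Measurable[⨆ i ≥ n, MeasurableSpace.comap (fun x : CantorSpace => x i) inferInstance]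
      ρ := by
    refine @measurable_pi_lambda _ _ _ (_) _ _ fun i => ?_
    by_cases hi : i < n
    · simp only [ρ, if_pos hi]
      exact @measurable_const _ _ (_) (_) _
    · simp only [ρ, if_neg hi]
      refine Measurable.of_comap_le ?_
      exact le_iSup₂_of_le i (not_lt.1 hi) le_rfl
  have hev : ∀ x, ∀ᶠ i in atTop, x i = ρ x i := fun x => by
    filter_upwards [eventually_ge_atTop n] with i hi
    simp [ρ, not_lt.2 hi]
  have : R = ρ ⁻¹' R := by
    ext x
    exact ⟨hinv _ _ (hev x), hinv _ _ ((hev x).mono fun _ h => h.symm)⟩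
  rw [this]
  exact hρ hR

/-- A measurable set which is not null is not covered by fewer than `cov(𝒩)` null sets. -/
theorem exists_mem_forall_notMem_of_card_lt {P : Set CantorSpace} (hP : MeasurableSet P)
    (hP0 : cantorMeasure P ≠ 0) {J : Type} {B : J → Set CantorSpace}
    (hB : ∀ j, cantorMeasure (B j) = 0) (hcov : ℵ₀ < covNull) (hJ : #J < covNull) :
    ∃ z ∈ P, ∀ j, z ∉ B j := by
  by_contra! hcon
  -- `R` is a tail set of positive measure, hence conull. If the `B j` covered `P`, their finite
  -- flips and `Rᶜ` would be too few null sets covering the space.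
  let R : Set CantorSpace := ⋃ q : Finset ℕ, flipCoords q ⁻¹' P
  have hR : MeasurableSet R :=
    .iUnion fun q => (measurePreserving_flipCoords q).measurable hP
  have hR1 : cantorMeasure R = 1 := by
    refine (cantorMeasure_eq_zero_or_one hR ?_).resolve_left ?_
    · intro x y hxy hx
      obtain ⟨q, hq⟩ := Set.mem_iUnion.1 hx
      obtain ⟨N, hN⟩ := eventually_atTop.1 hxy
      have : flipCoords ((q ∪ Finset.range N).filter fun i => flipCoords q x i ≠ y i) y =
          flipCoords q x := by
        funext i
        by_cases hi : i ∈ q ∪ Finset.range N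
        · by_cases h : flipCoords q x i = y i
          · have : i ∉ (q ∪ Finset.range N).filter fun i => flipCoords q x i ≠ y i :=
              fun h' => (Finset.mem_filter.1 h').2 h
            rw [h, flipCoords, if_neg this]
          · have : i ∈ (q ∪ Finset.range N).filter fun i => flipCoords q x i ≠ y i :=
              Finset.mem_filter.2 ⟨hi, h⟩
            rw [flipCoords, if_pos this]
            revert h
            cases flipCoords q x i <;> cases y i <;> simp
        · have h1 : i ∉ (q ∪ Finset.range N).filter fun i => flipCoords q x i ≠ y i :=
            fun h => hi (Finset.mem_filter.1 h).1
          rw [Finset.mem_union, not_or, Finset.mem_range, not_lt] at hi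
          rw [flipCoords, if_neg h1, flipCoords, if_neg hi.1, hN i hi.2]
      refine Set.mem_iUnion.2 ⟨(q ∪ Finset.range N).filter fun i => flipCoords q x i ≠ y i, ?_⟩
      rw [Set.mem_preimage, this]
      exact hq
    · refine fun h => hP0 ?_
      rw [← (measurePreserving_flipCoords ∅).measure_preimage hP.nullMeasurableSet]
      exact measure_mono_null (Set.subset_iUnion (fun q => flipCoords q ⁻¹' P) ∅) h
  have hnull : ∀ o : Option (Finset ℕ × J), cantorMeasure
      (o.elim Rᶜ fun p => flipCoords p.1 ⁻¹' B p.2) = 0 := by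
    rintro (_ | ⟨q, j⟩)
    · exact (prob_compl_eq_zero_iff hR).2 hR1
    · exact (measurePreserving_flipCoords q).quasiMeasurePreserving.preimage_null (hB j)
  refine (?_ : ¬ covNull ≤ #(Option (Finset ℕ × J))) ?_
  · rw [not_le, mk_option, mk_prod, lift_id, lift_id]
    refine add_lt_of_lt hcov.le (mul_lt_of_lt hcov.le ?_ hJ) (one_lt_aleph0.trans hcov)
    rwa [mk_eq_aleph0]
  · refine le_trans (csInf_le' ⟨Set.range fun o : Option (Finset ℕ × J) =>
      (o.elim Rᶜ fun p => flipCoords p.1 ⁻¹' B p.2), ?_, ?_, rfl⟩) mk_range_le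
    · rintro _ ⟨o, rfl⟩
      exact hnull o
    · rw [Set.sUnion_range, Set.eq_univ_iff_forall]
      intro x
      by_cases hx : x ∈ R
      · obtain ⟨q, hq⟩ := Set.mem_iUnion.1 hx
        obtain ⟨j, hj⟩ := hcon _ hq
        exact Set.mem_iUnion.2 ⟨some (q, j), hj⟩
      · exact Set.mem_iUnion.2 ⟨none, hx⟩

/-! ### `S₁(Γ, O)` -/

/-- The set of points `x` such that `m` is the first place where the `n`-th row of `x`, regarded as
an `ℕ × ℕ` matrix, has the value `true`. -/
def firstTrueSet (n m : ℕ) : Set CantorSpace :=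
  {x | x (Nat.pair n m) = true ∧ ∀ i < m, x (Nat.pair n i) = false}

theorem isClosed_firstTrueSet (n m : ℕ) : IsClosed (firstTrueSet n m) := by
  have h : ∀ (i : ℕ) (b : Bool), IsClosed {x : CantorSpace | x i = b} := fun i b =>
    isClosed_eq (continuous_apply i) continuous_const
  have : firstTrueSet n m = {x | x (Nat.pair n m) = true} ∩
      ⋂ i, ⋂ _ : i < m, {x | x (Nat.pair n i) = false} := by
    ext x; simp [firstTrueSet]
  rw [this]
  exact (h _ _).inter (isClosed_iInter fun i => isClosed_iInter fun _ => h _ _)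

theorem eq_of_mem_firstTrueSet {n m k : ℕ} {x : CantorSpace} (hm : x ∈ firstTrueSet n m)
    (hk : x ∈ firstTrueSet n k) : m = k := by
  rcases lt_trichotomy m k with h | h | h
  · exact absurd (hk.2 m h) (by simp [hm.1])
  · exact h
  · exact absurd (hm.2 k h) (by simp [hk.1])

theorem exists_forall_mem_firstTrueSet (f : ℕ → ℕ) : ∃ x, ∀ n, x ∈ firstTrueSet n (f n) := by
  refine ⟨fun k => decide ((Nat.unpair k).2 = f (Nat.unpair k).1), fun n => ⟨by simp, ?_⟩⟩
  intro i hi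
  simpa using hi.ne

/-- A space that can be mapped continuously onto the Cantor space is not `S₁(Γ, O)`. -/
theorem not_isS1GammaO_of_surjective {X : Type*} [TopologicalSpace X] {g : X → CantorSpace}
    (hg : Continuous g) (hsurj : Function.Surjective g) : ¬ IsS1GammaO X := by
  intro h
  have hinj : ∀ n, Function.Injective fun m => (g ⁻¹' firstTrueSet n m)ᶜ := by
    intro n m k hmk
    obtain ⟨y, hy⟩ := exists_forall_mem_firstTrueSet fun _ => m
    obtain ⟨x, rfl⟩ := hsurj y
    have hx : x ∈ g ⁻¹' firstTrueSet n m := hy n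
    exact eq_of_mem_firstTrueSet (hy n) (show x ∈ g ⁻¹' firstTrueSet n k from
      compl_inj_iff.1 hmk ▸ hx)
  obtain ⟨U, hU, hcov⟩ := h (fun n => Set.range fun m => (g ⁻¹' firstTrueSet n m)ᶜ) fun n => by
    refine ⟨?_, Set.infinite_range_of_injective (hinj n), fun x => ?_⟩
    · rintro _ ⟨m, rfl⟩
      exact ((isClosed_firstTrueSet n m).preimage hg).isOpen_compl
    · refine Set.Subsingleton.finite ?_
      rintro _ ⟨⟨m, rfl⟩, hm⟩ _ ⟨⟨k, rfl⟩, hk⟩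
      have : m = k := eq_of_mem_firstTrueSet (x := g x) (not_not.1 hm) (not_not.1 hk)
      rw [this]
  choose f hf using hU
  obtain ⟨y, hy⟩ := exists_forall_mem_firstTrueSet f
  obtain ⟨x, rfl⟩ := hsurj y
  obtain ⟨n, hn⟩ := Set.mem_iUnion.1 (hcov.ge (Set.mem_univ x))
  rw [← hf n] at hn
  exact hn (hy n)

/-! ### A sufficient condition for the Hurewicz property -/

theorem exists_bound_of_card_lt {B : Set (ℕ → ℕ)} (hB : #B < boundingNumber) :
    ∃ g : ℕ → ℕ, ∀ f ∈ B, ∀ᶠ n in atTop, f n ≤ g n := by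
  by_contra h
  exact notMem_of_lt_csInf' hB ⟨B, h, rfl⟩

/-- If every `G_δ` set containing `X` contains a `σ`-compact set which covers all but fewer than `𝔟`
points of `X`, then `X` is Hurewicz. -/
theorem isHurewicz_of_exists_isCompact {T : Type} [TopologicalSpace T] [SecondCountableTopology T]
    {X : Set T} (hb : ℵ₀ < boundingNumber)
    (h : ∀ G : ℕ → Set T, (∀ n, IsOpen (G n)) → (∀ n, X ⊆ G n) →
      ∃ F : ℕ → Set T, (∀ k, IsCompact (F k)) ∧ (∀ k n, F k ⊆ G n) ∧
        #↥(X \ ⋃ k, F k) < boundingNumber) : IsHurewicz X := by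
  intro 𝒰 h𝒰
  rcases isEmpty_or_nonempty X with hX | ⟨⟨x₀⟩⟩
  · exact ⟨fun _ => ∅, fun n => ⟨Set.empty_subset _, Set.finite_empty⟩, fun x => isEmptyElim x⟩
  have hW : ∀ n, ∃ W : ℕ → Set T,
      (∀ m, IsOpen (W m) ∧ (Subtype.val ⁻¹' W m : Set X) ∈ 𝒰 n) ∧ X ⊆ ⋃ m, W m := by
    intro n
    obtain ⟨𝒯, h𝒯c, h𝒯s, h𝒯⟩ := TopologicalSpace.isOpen_sUnion_countable
      {W : Set T | IsOpen W ∧ (Subtype.val ⁻¹' W : Set X) ∈ 𝒰 n} fun _ h => h.1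
    have hX : X ⊆ ⋃₀ 𝒯 := by
      intro x hx
      rw [h𝒯]
      obtain ⟨U, hU, hxU⟩ := (h𝒰 n).2.ge (Set.mem_univ (⟨x, hx⟩ : X))
      obtain ⟨W, hWo, rfl⟩ := isOpen_induced_iff.1 ((h𝒰 n).1 U hU)
      exact ⟨W, ⟨hWo, hU⟩, hxU⟩
    obtain ⟨W₀, hW₀, -⟩ := hX x₀.2
    obtain ⟨W, rfl⟩ := h𝒯c.exists_eq_range ⟨W₀, hW₀⟩
    exact ⟨W, fun m => h𝒯s ⟨m, rfl⟩, by rwa [← Set.sUnion_range]⟩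
  choose W hWo hWX using hW
  obtain ⟨F, hFc, hFG, hFX⟩ := h (fun n => ⋃ m, W n m)
    (fun n => isOpen_iUnion fun m => (hWo n m).1) hWX
  have hf : ∀ k n, ∃ m, F k ⊆ ⋃ j ≤ m, W n j := by
    intro k n
    obtain ⟨t, ht⟩ := (hFc k).elim_finite_subcover (W n) (fun m => (hWo n m).1) (hFG k n)
    refine ⟨t.sup id, ht.trans (Set.iUnion₂_subset fun j hj => ?_)⟩
    exact Set.subset_biUnion_of_mem (u := W n) (show j ≤ t.sup id from Finset.le_sup (f := id) hj)
  choose f hf using hf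
  have hg : ∀ (x : X) n, ∃ m, (x : T) ∈ W n m := fun x n => Set.mem_iUnion.1 (hWX n x.2)
  choose g hg using hg
  obtain ⟨b, hb⟩ := exists_bound_of_card_lt
    (B := Set.range f ∪ Set.range fun x : ↥(X \ ⋃ k, F k) => g ⟨x, x.2.1⟩) <| by
    refine (mk_union_le _ _).trans_lt (add_lt_of_lt hb.le ?_ (mk_range_le.trans_lt hFX))
    exact (mk_range_le.trans_eq mk_nat).trans_lt hb
  refine ⟨fun n => (fun j => (Subtype.val ⁻¹' W n j : Set X)) '' Set.Iic (b n), fun n => ⟨?_, ?_⟩,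
    fun x => ?_⟩
  · rintro _ ⟨j, -, rfl⟩
    exact (hWo n j).2
  · exact (Set.finite_Iic _).image _
  · suffices h : ∀ᶠ n in atTop, ∃ j ≤ b n, (x : T) ∈ W n j by
      rw [← Nat.cofinite_eq_atTop] at h
      refine Set.Finite.subset h fun n hn => ?_
      rintro ⟨j, hj, hxj⟩
      exact hn ⟨_, ⟨j, hj, rfl⟩, hxj⟩
    by_cases hx : (x : T) ∈ ⋃ k, F k
    · obtain ⟨k, hk⟩ := Set.mem_iUnion.1 hx
      filter_upwards [hb (f k) (Or.inl ⟨k, rfl⟩)] with n hn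
      obtain ⟨j, hj, hxj⟩ := Set.mem_iUnion₂.1 (hf k n hk)
      exact ⟨j, hj.trans hn, hxj⟩
    · filter_upwards [hb (g x) (Or.inr ⟨⟨x, x.2, hx⟩, rfl⟩)] with n hn
      exact ⟨_, hn, hg x n⟩

/-! ### Sets with null vertical sections -/

/-- A closed subset of the plane with null vertical sections has open neighbourhoods whose vertical
sections are uniformly small. -/
theorem exists_isOpen_section_lt {H : Set (CantorSpace × CantorSpace)} (hH : IsClosed H)
    (hH0 : ∀ y, cantorMeasure (Prod.mk y ⁻¹' H) = 0) {ε : ENNReal} (hε : ε ≠ 0) :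
    ∃ V, IsOpen V ∧ H ⊆ V ∧ ∀ y, cantorMeasure (Prod.mk y ⁻¹' V) ≤ ε := by
  suffices h : ∃ V, IsOpen V ∧ H ⊆ V ∧ ∀ y ∈ Set.univ, cantorMeasure (Prod.mk y ⁻¹' V) ≤ ε by
    simpa using h
  -- The property passes to subsets and, by intersecting neighbourhoods, to unions, so it need only
  -- hold near each `y`.
  refine isCompact_univ.induction_on
    (p := fun S => ∃ V, IsOpen V ∧ H ⊆ V ∧ ∀ y ∈ S, cantorMeasure (Prod.mk y ⁻¹' V) ≤ ε)
    ⟨Set.univ, isOpen_univ, Set.subset_univ _, fun y hy => hy.elim⟩ ?_ ?_ ?_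
  · rintro S S' hSS' ⟨V, hV, hHV, hS⟩
    exact ⟨V, hV, hHV, fun y hy => hS y (hSS' hy)⟩
  · rintro S S' ⟨V, hV, hHV, hS⟩ ⟨V', hV', hHV', hS'⟩
    refine ⟨V ∩ V', hV.inter hV', Set.subset_inter hHV hHV', ?_⟩
    rintro y (hy | hy)
    · exact (measure_mono (Set.preimage_mono Set.inter_subset_left)).trans (hS y hy)
    · exact (measure_mono (Set.preimage_mono Set.inter_subset_right)).trans (hS' y hy)
  · intro y _
    obtain ⟨O, hOH, hO, hOε⟩ := (Prod.mk y ⁻¹' H).exists_isOpen_lt_of_lt ε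
      (by rw [hH0 y]; exact pos_iff_ne_zero.2 hε)
    have hdisj : Disjoint H ({y} ×ˢ Oᶜ) := by
      rw [Set.disjoint_left]
      rintro ⟨y', z⟩ hz ⟨hy', hzO⟩
      obtain rfl : y' = y := hy'
      exact hzO (hOH hz)
    obtain ⟨V, V', hV, hV', hHV, hKV', hVV'⟩ := SeparatedNhds.of_isCompact_isCompact hH.isCompact
      (isCompact_singleton.prod hO.isClosed_compl.isCompact) hdisj
    obtain ⟨A, B, hA, -, hyA, hOB, hAB⟩ := generalized_tube_lemma isCompact_singleton
      hO.isClosed_compl.isCompact hV' hKV'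
    refine ⟨A, mem_nhdsWithin_of_mem_nhds (hA.mem_nhds (hyA rfl)), V, hV, hHV, fun y' hy' => ?_⟩
    refine (measure_mono fun z hz => ?_).trans hOε.le
    by_contra hzO
    exact Set.disjoint_left.1 hVV' hz (hAB ⟨hy', hOB hzO⟩)

/-- The complement of an `F_σ` set with null vertical sections contains a `σ`-compact set whose
complement has null vertical sections. -/
theorem exists_isCompact_compl_section_null {H : ℕ → Set (CantorSpace × CantorSpace)}
    (hH : ∀ n, IsClosed (H n)) (hH0 : ∀ n y, cantorMeasure (Prod.mk y ⁻¹' H n) = 0) :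
    ∃ F : ℕ → Set (CantorSpace × CantorSpace), (∀ k, IsCompact (F k)) ∧
      (∀ k n, Disjoint (F k) (H n)) ∧ ∀ y, cantorMeasure (Prod.mk y ⁻¹' (⋃ k, F k)ᶜ) = 0 := by
  -- The `k`-th compact set omits an open neighbourhood of all the `H n` whose sections have measure
  -- at most `1 / (k + 1)`.
  have hε : ∀ k : ℕ, ∃ ε : ℕ → ENNReal, (∀ n, 0 < ε n) ∧ ∑' n, ε n < ((k : ENNReal) + 1)⁻¹ :=
    fun k => ENNReal.exists_pos_sum_of_countable'
      (ENNReal.inv_ne_zero.2 (by finiteness)) ℕ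
  choose ε hε0 hε using hε
  choose V hVo hHV hV using fun k n => exists_isOpen_section_lt (hH n) (hH0 n) (hε0 k n).ne'
  refine ⟨fun k => (⋃ n, V k n)ᶜ,
    fun k => (isOpen_iUnion fun n => hVo k n).isClosed_compl.isCompact, fun k n => ?_, fun y => ?_⟩
  · rw [Set.disjoint_compl_left_iff_subset]
    exact (hHV k n).trans (Set.subset_iUnion _ _)
  · have hle : ∀ k : ℕ, cantorMeasure (Prod.mk y ⁻¹' (⋃ k, (⋃ n, V k n)ᶜ)ᶜ) ≤
        ((k : ENNReal) + 1)⁻¹ := by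
      intro k
      refine le_trans (measure_mono ?_) ((measure_iUnion_le fun n => Prod.mk y ⁻¹' V k n).trans
        ((ENNReal.tsum_le_tsum fun n => hV k n y).trans (hε k).le))
      intro z hz
      simp only [Set.compl_iUnion, Set.mem_preimage, Set.mem_iInter] at hz
      simpa using hz k
    by_contra h0
    obtain ⟨k, hk⟩ := ENNReal.exists_inv_nat_lt h0
    refine absurd (hle k) (not_le.2 (lt_of_le_of_lt ?_ hk))
    exact ENNReal.inv_le_inv.2 le_self_add

/-! ### The construction -/

theorem mk_cantorSpace : #CantorSpace = 𝔠 := by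
  simp [CantorSpace]

/-- The sequences of closed subsets of a second countable space can be indexed by the points of the
Cantor space. -/
theorem exists_enumeration_isClosed (T : Type*) [TopologicalSpace T]
    [SecondCountableTopology T] : ∃ H : CantorSpace → ℕ → Set T, (∀ i n, IsClosed (H i n)) ∧
      ∀ K : ℕ → Set T, (∀ n, IsClosed (K n)) → ∃ i, H i = K := by
  have hb := TopologicalSpace.isBasis_countableBasis T
  obtain ⟨B, hB⟩ := ((TopologicalSpace.countable_countableBasis T).insert ∅).exists_eq_range
    (Set.insert_nonempty _ _)
  have hBo : ∀ m, IsOpen (B m) := fun m => by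
    rcases hB.ge ⟨m, rfl⟩ with h | h
    · rw [h]; exact isOpen_empty
    · exact hb.isOpen h
  obtain ⟨e⟩ : Nonempty (CantorSpace ≃ (ℕ → Set ℕ)) := by
    rw [← Cardinal.eq, mk_cantorSpace]
    simp
  -- An index codes, for each `n`, which basic open sets make up the complement of the `n`-th closed
  -- set.
  refine ⟨fun i n => (⋃ m ∈ e i n, B m)ᶜ,
    fun i n => (isOpen_biUnion fun m _ => hBo m).isClosed_compl, fun K hK => ?_⟩
  refine ⟨e.symm fun n => {m | B m ⊆ (K n)ᶜ}, funext fun n => ?_⟩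
  simp only [e.apply_symm_apply]
  rw [compl_eq_comm]
  refine Set.Subset.antisymm (fun x hx => ?_) (Set.iUnion₂_subset fun m hm => hm)
  obtain ⟨U, hU, hxU, hUK⟩ := hb.exists_subset_of_mem_open hx (hK n).isOpen_compl
  obtain ⟨m, rfl⟩ := hB.le (Or.inr hU)
  exact Set.mem_iUnion₂.2 ⟨m, hUK, hxU⟩

theorem exists_wellOrder_cantorSpace : ∃ r : CantorSpace → CantorSpace → Prop,
    IsWellOrder CantorSpace r ∧ ∀ i, #{j // r j i} < 𝔠 := by
  obtain ⟨r, hr, h⟩ := exists_ord_eq CantorSpace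
  refine ⟨r, hr, fun i => ?_⟩
  have := card_typein_lt i h
  rwa [mk_cantorSpace] at this

/-- The `σ`-compact sets `F i` are fixed beforehand, so the points at stage `i` only have to lie in
the earlier `F j`. On a vertical line this avoids fewer than `cov(𝒩)` null sets, which is possible
inside any non-null closed section. -/
theorem exists_plane_set (hcov : covNull = 𝔠) : ∃ X : Set (CantorSpace × CantorSpace),
    (∀ y, ∃ p ∈ X, p.1 = y) ∧
    (∀ H : ℕ → Set (CantorSpace × CantorSpace), (∀ n, IsClosed (H n)) →
      (∀ n, Disjoint X (H n)) → ∀ n y, cantorMeasure (Prod.mk y ⁻¹' H n) = 0) ∧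
    ∀ H : ℕ → Set (CantorSpace × CantorSpace), (∀ n, IsClosed (H n)) →
      (∀ n y, cantorMeasure (Prod.mk y ⁻¹' H n) = 0) →
      ∃ F : ℕ → Set (CantorSpace × CantorSpace), (∀ k, IsCompact (F k)) ∧
      (∀ k n, Disjoint (F k) (H n)) ∧ #↥(X \ ⋃ k, F k) < 𝔠 := by
  obtain ⟨r, hr, hrc⟩ := exists_wellOrder_cantorSpace
  obtain ⟨H, hH, hHsurj⟩ := exists_enumeration_isClosed (CantorSpace × CantorSpace)
  have hF : ∀ i, ∃ F : ℕ → Set (CantorSpace × CantorSpace),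
      (∀ y, cantorMeasure (Prod.mk y ⁻¹' (⋃ k, F k)ᶜ) = 0) ∧
      ((∀ n y, cantorMeasure (Prod.mk y ⁻¹' H i n) = 0) →
        (∀ k, IsCompact (F k)) ∧ ∀ k n, Disjoint (F k) (H i n)) := by
    intro i
    by_cases hi : ∀ n y, cantorMeasure (Prod.mk y ⁻¹' H i n) = 0
    · obtain ⟨F, h1, h2, h3⟩ := exists_isCompact_compl_section_null (hH i) hi
      exact ⟨F, h3, fun _ => ⟨h1, h2⟩⟩
    -- Indices with a non-null section impose no constraint on later points.
    · exact ⟨fun _ => Set.univ, by simp [Set.iUnion_const], fun h => absurd h hi⟩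
  choose F hF0 hF using hF
  have key : ∀ (i y : CantorSpace) (P : Set CantorSpace), MeasurableSet P →
      cantorMeasure P ≠ 0 → ∃ z ∈ P, ∀ j, r j i → (y, z) ∈ ⋃ k, F j k := by
    intro i y P hP hP0
    obtain ⟨z, hz, hzF⟩ := exists_mem_forall_notMem_of_card_lt hP hP0
      (B := fun j : {j // r j i} => Prod.mk y ⁻¹' (⋃ k, F j k)ᶜ) (fun j => hF0 j y)
      (hcov ▸ aleph0_lt_continuum) (hcov ▸ hrc i)
    exact ⟨z, hz, fun j hj => not_not.1 (hzF ⟨j, hj⟩)⟩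
  have hu : ∀ i, ∃ p : CantorSpace × CantorSpace, p.1 = i ∧ ∀ j, r j i → p ∈ ⋃ k, F j k := by
    intro i
    obtain ⟨z, -, hz⟩ := key i i Set.univ .univ (by simp)
    exact ⟨(i, z), rfl, hz⟩
  have hv : ∀ i, ∃ p : CantorSpace × CantorSpace, (∀ j, r j i → p ∈ ⋃ k, F j k) ∧
      ((∀ n, p ∉ H i n) → ∀ n y, cantorMeasure (Prod.mk y ⁻¹' H i n) = 0) := by
    intro i
    by_cases hi : ∀ n y, cantorMeasure (Prod.mk y ⁻¹' H i n) = 0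
    · obtain ⟨p, -, hp⟩ := hu i
      exact ⟨p, hp, fun _ => hi⟩
    · push Not at hi
      obtain ⟨n, y, hny⟩ := hi
      obtain ⟨z, hzH, hz⟩ := key i y _
        ((hH i n).preimage (Continuous.prodMk_right y)).measurableSet hny
      exact ⟨(y, z), hz, fun h => absurd hzH (h n)⟩
  choose u hu1 hu using hu
  choose v hv hvH using hv
  refine ⟨Set.range u ∪ Set.range v, fun y => ⟨u y, Or.inl ⟨y, rfl⟩, hu1 y⟩, ?_, ?_⟩
  · intro K hK hKX
    obtain ⟨i, rfl⟩ := hHsurj K hK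
    exact hvH i fun n => Set.disjoint_left.1 (hKX n) (Or.inr ⟨i, rfl⟩)
  · intro K hK hK0
    obtain ⟨i, rfl⟩ := hHsurj K hK
    obtain ⟨hFc, hFH⟩ := hF i hK0
    refine ⟨F i, hFc, hFH, ?_⟩
    have hS : #↥({j | r j i} ∪ {i}) < 𝔠 :=
      (mk_union_le _ _).trans_lt (add_lt_of_lt aleph0_le_continuum (hrc i)
        ((mk_singleton i).trans_lt (one_lt_aleph0.trans aleph0_lt_continuum)))
    refine (mk_le_mk_of_subset (t := u '' ({j | r j i} ∪ {i}) ∪ v '' ({j | r j i} ∪ {i}))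
      ?_).trans_lt ((mk_union_le _ _).trans_lt (add_lt_of_lt aleph0_le_continuum
        (mk_image_le.trans_lt hS) (mk_image_le.trans_lt hS)))
    -- Points chosen after stage `i` lie in `⋃ k, F i k`; only those with index up to `i` can be
    -- left over.
    have hle : ∀ j, ¬ r i j → j ∈ {j | r j i} ∪ {i} := fun j hj => by
      rcases trichotomous_of r j i with h | h | h
      · exact Or.inl h
      · exact Or.inr h
      · exact absurd h hj
    rintro p ⟨⟨j, rfl⟩ | ⟨j, rfl⟩, hp⟩
    · exact Or.inl ⟨j, hle j fun h => hp (hu j i h), rfl⟩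
    · exact Or.inr ⟨j, hle j fun h => hp (hv j i h), rfl⟩

/-! ### Small closed sets and total imperfection -/

instance : NullSingletonClass cantorMeasure := by
  refine ⟨fun x => ?_⟩
  have hle : ∀ n : ℕ, cantorMeasure {x} ≤ (2⁻¹ : ENNReal) ^ n := by
    intro n
    have h := Measure.infinitePi_pi (fun _ : ℕ => (PMF.uniformOfFintype Bool).toMeasure)
      (s := Finset.range n) (t := fun i => {x i}) fun i _ => MeasurableSet.singleton (x i)
    simp only [PMF.toMeasure_apply_singleton _ _ (MeasurableSet.singleton _),
      PMF.uniformOfFintype_apply, Fintype.card_bool, Finset.prod_const, Finset.card_range] at h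
    refine le_trans (measure_mono ?_) h.le
    rintro _ rfl i -
    rfl
  exact le_antisymm (ge_of_tendsto' (ENNReal.tendsto_pow_atTop_nhds_zero_of_lt_one
    (by simp)) hle) bot_le

/-- The Cantor space is homeomorphic to its square. -/
noncomputable def cantorSpaceHomeomorphProd : CantorSpace ≃ₜ CantorSpace × CantorSpace :=
  (Homeomorph.piCongrLeft (Y := fun _ => Bool) Equiv.natSumNatEquivNat).symm.trans
    Homeomorph.sumArrowHomeomorphProdArrow

/-- An uncountable closed subset of the Cantor space contains a closed null set of size `𝔠`. -/
theorem exists_isClosed_null_subset {P : Set CantorSpace} (hP : IsClosed P)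
    (hP0 : ¬ P.Countable) :
    ∃ K ⊆ P, IsClosed K ∧ cantorMeasure K = 0 ∧ #K = 𝔠 := by
  have : TopologicalSpace.IsCompletelyMetrizableSpace Bool :=
    TopologicalSpace.IsCompletelyMetrizableSpace.discrete
  have : PolishSpace CantorSpace := { }
  obtain ⟨f, hfP, hf, hfinj⟩ := hP.exists_nat_bool_injection_of_not_countable hP0
  -- The Cantor set inside `P` splits into `𝔠` disjoint closed copies of itself, of which only
  -- countably many have positive measure.
  let g : CantorSpace → CantorSpace → CantorSpace :=
    fun t s => f (cantorSpaceHomeomorphProd.symm (t, s))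
  have hg : ∀ t, Continuous (g t) := fun t =>
    hf.comp (cantorSpaceHomeomorphProd.symm.continuous.comp (Continuous.prodMk_right t))
  have hginj : ∀ {t s t' s'}, g t s = g t' s' → t = t' ∧ s = s' := fun h =>
    Prod.mk.inj (cantorSpaceHomeomorphProd.symm.injective (hfinj h))
  have hK : ∀ t, IsClosed (Set.range (g t)) := fun t => (isCompact_range (hg t)).isClosed
  have hcount := Measure.countable_meas_pos_of_disjoint_iUnion (μ := cantorMeasure)
    (fun t => (hK t).measurableSet) fun t t' htt' => by
      rw [Function.onFun, Set.disjoint_left]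
      rintro _ ⟨s, rfl⟩ ⟨s', hs'⟩
      exact htt' (hginj hs').1.symm
  have huncount : ¬ (Set.univ : Set CantorSpace).Countable := by
    rw [← le_aleph0_iff_set_countable, mk_univ, mk_cantorSpace, not_le]
    exact aleph0_lt_continuum
  obtain ⟨t, ht⟩ : ∃ t, cantorMeasure (Set.range (g t)) = 0 := by
    by_contra! h
    exact huncount (hcount.mono fun t _ => pos_iff_ne_zero.2 (h t))
  refine ⟨Set.range (g t), ?_, hK t, ht, ?_⟩
  · rintro _ ⟨s, rfl⟩
    exact hfP ⟨_, rfl⟩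
  · rw [mk_range_eq _ fun s s' h => (hginj h).2, mk_cantorSpace]

theorem mainTheorem3 :
    ¬ IsS1GammaO CantorSpace ∧
    (covNull = boundingNumber → boundingNumber = Cardinal.continuum.{0} →
      ∃ X : Set CantorSpace,
        IsHurewicz X ∧ IsTotallyImperfect X ∧
        (∃ f : X → CantorSpace, Continuous f ∧ Function.Surjective f) ∧
        ¬ IsS1GammaO X) := by
  refine ⟨not_isS1GammaO_of_surjective continuous_id Function.surjective_id, fun hcb hbc => ?_⟩
  obtain ⟨X, hXfst, hXnull, hXsmall⟩ := exists_plane_set (hcb.trans hbc)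
  let φ := cantorSpaceHomeomorphProd
  have hf : Continuous fun x : φ ⁻¹' X => (φ x).1 :=
    continuous_fst.comp (φ.continuous.comp continuous_subtype_val)
  have hfsurj : Function.Surjective fun x : φ ⁻¹' X => (φ x).1 := by
    intro y
    obtain ⟨p, hp, rfl⟩ := hXfst y
    exact ⟨⟨φ.symm p, by simpa using hp⟩, by simp⟩
  refine ⟨φ ⁻¹' X, ?_, ?_, ⟨_, hf, hfsurj⟩, not_isS1GammaO_of_surjective hf hfsurj⟩
  · refine isHurewicz_of_exists_isCompact (hbc ▸ aleph0_lt_continuum) fun G hG hXG => ?_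
    have hcl : ∀ n, IsClosed (φ.symm ⁻¹' G n)ᶜ := fun n =>
      ((hG n).preimage φ.symm.continuous).isClosed_compl
    obtain ⟨F, hFc, hFG, hFX⟩ := hXsmall _ hcl <| hXnull _ hcl fun n => by
      rw [Set.disjoint_compl_right_iff_subset]
      exact fun p hp => hXG n (by simpa using hp)
    refine ⟨fun k => φ ⁻¹' F k, fun k => φ.isCompact_preimage.2 (hFc k), fun k n x hx => ?_, ?_⟩
    · simpa using Set.disjoint_compl_right_iff_subset.1 (hFG k n) hx
    · rw [hbc, ← Set.preimage_iUnion, ← Set.preimage_sdiff]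
      exact (mk_preimage_of_injective _ _ φ.injective).trans_lt hFX
  · have hsmall : ∀ Q ⊆ X, IsClosed Q → (∀ y, cantorMeasure (Prod.mk y ⁻¹' Q) = 0) → #Q < 𝔠 := by
      intro Q hQX hQ hQ0
      obtain ⟨F, -, hFQ, hFX⟩ := hXsmall (fun _ => Q) (fun _ => hQ) fun _ => hQ0
      have hQF : Q ⊆ X \ ⋃ k, F k := fun p hp => ⟨hQX hp, fun hpF => ?_⟩
      · exact (mk_le_mk_of_subset hQF).trans_lt hFX
      obtain ⟨k, hk⟩ := Set.mem_iUnion.1 hpF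
      exact Set.disjoint_left.1 (hFQ k 0) hk hp
    rintro ⟨P, hPX, ⟨e⟩⟩
    have hPc : IsCompact P := by
      rw [isCompact_iff_compactSpace]
      exact e.symm.compactSpace
    have hQ : IsClosed (φ '' P) := (hPc.image φ.continuous).isClosed
    have hQX : φ '' P ⊆ X := Set.image_subset_iff.2 hPX
    by_cases h0 : ∀ y, cantorMeasure (Prod.mk y ⁻¹' (φ '' P)) = 0
    · refine (hsmall _ hQX hQ h0).ne ?_
      rw [mk_image_eq φ.injective, mk_congr e.toEquiv, mk_cantorSpace]
    · push Not at h0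
      obtain ⟨y, hy⟩ := h0
      -- The non-null section is uncountable, so it contains a null closed `K` of size `𝔠`; then
      -- `{y} × K` has null sections and is too large.
      obtain ⟨K, hKP, hK, hK0, hKc⟩ := exists_isClosed_null_subset
        (hQ.preimage (Continuous.prodMk_right y)) fun h => hy (h.measure_zero _)
      have hinj : Function.Injective (Prod.mk y : CantorSpace → CantorSpace × CantorSpace) :=
        Prod.mk_right_injective y
      refine (hsmall (Prod.mk y '' K) ?_ ?_ fun y' => measure_mono_null ?_ hK0).ne ?_
      · exact (Set.image_subset_iff.2 hKP).trans hQX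
      · exact (hK.isCompact.image (Continuous.prodMk_right y)).isClosed
      · rintro z ⟨z', hz', h⟩
        rwa [← (Prod.mk.inj h).2]
      · rw [mk_image_eq hinj, hKc]
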